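/- There is a universal constant $c>0$ such that the following holds. Let $d,n\ge 1$, let $T\in\mathbb{R}^{d\times d}$ be a positive semidefinite symmetric Toeplitz matrix, let $\Delta>0$, and let $R\subset\{1,\dots,d\}$ be a ruler, i.e. for every $s\in\{0,\dots,d-1\}$ the set $R_s=\{(j,k)\in R\times R:\ |j-k|=s\}$ is non-empty. Let $x^{(1)},\dots,x^{(n)}$ be i.i.d. random vectors with law $\mathcal N(0,T)$. Independently of them, let $\tau^{(l)}_i$ ($1\le l\le n$, $1\le i\le d$) be i.i.d. triangular dithers, i.e. each $\tau^{(l)}_i$ is distributed as the sum of two independent random variables uniform on $[-\Delta/2,\Delta/2]$. Let $\dot x^{(l)}_i=\Delta\bigl(\lfloor (x^{(l)}_i+\tau^{(l)}_i)/\Delta\rfloor+\tfrac12\bigr)$ be the quantized data, put $$\dot a_s=\frac{1}{n|R_s|}\sum_{l=1}^n\sum_{(j,k)\in R_s}\dot x^{(l)}_j\dot x^{(l)}_k\qquad(0\le s\le d-1),$$ and define the estimator $\hat T$ by $\hat T_{jk}=\dot a_{|j-k|}-\tfrac{\Delta^2}{4}\mathbf 1_{\{j=k\}}$. Write $\|M\|_\infty=\max_{j,k}|M_{jk}|$,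 let $\|M\|_2$ denote the (Euclidean) operator norm, and let $K=2(\|T\|_2+2\Delta^2)$. Then for every real $t$ $$\mathbb P\bigl\{\|T-\hat T\|_\infty\ge t\bigr\}\le 2|R|\exp\Bigl[-cn\min\Bigl(\frac{t^2}{K^2},\frac{t}{K}\Bigr)\Bigr],$$ and in particular, for every $\epsilon\in(0,1]$, $$\mathbb P\bigl\{\|T-\hat T\|_\infty\ge \epsilon\|T\|_\infty\bigr\}\le 2|R|\exp\Bigl[-\frac{cn\epsilon^2\|T\|_\infty^2}{K^2}\Bigr].$$ -/

import Mathlib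

open MeasureTheory ProbabilityTheory

noncomputable section

namespace QuantizedToeplitz

/-- The distance of two indices in `{0, …, d - 1}` is again an index in `{0, …, d - 1}`. -/
theorem dist_lt {d : ℕ} (j k : Fin d) : Nat.dist j k < d := by
  have hj := j.isLt
  have hk := k.isLt
  simp only [Nat.dist]
  omega

/-- The distance `|j - k|` of two indices. -/
def indexDist {d : ℕ} (j k : Fin d) : Fin d := ⟨Nat.dist j k, dist_lt j k⟩

/-- The symmetric Toeplitz matrix `Toep(a)`, with `(j, k)` entry `a_{|j - k|}`. -/
def toep {d : ℕ} (a : Fin d → ℝ) : Matrix (Fin d) (Fin d) ℝ :=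
  Matrix.of fun j k => a (indexDist j k)

/-- A real matrix is symmetric Toeplitz if it is `Toep(a)` for some vector `a`. -/
def IsSymmToeplitz {d : ℕ} (T : Matrix (Fin d) (Fin d) ℝ) : Prop :=
  ∃ a : Fin d → ℝ, T = toep a

/-- A set of indices is a ruler if every distance `s = 0, …, d - 1` occurs between
two of its elements. -/
def IsRuler {d : ℕ} (R : Finset (Fin d)) : Prop :=
  ∀ s : Fin d, ∃ j ∈ R, ∃ k ∈ R, indexDist j k = s

/-- `R_s`, the set of ordered pairs of elements of `R` at distance `s`. -/
def rulerPairs {d : ℕ} (R : Finset (Fin d)) (s : Fin d) : Finset (Fin d × Fin d) :=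
  (R ×ˢ R).filter fun p => indexDist p.1 p.2 = s

/-- The scalar quantizer `Q_Δ(x) = Δ (⌊x / Δ⌋ + 1 / 2)`. -/
def quantize (Δ x : ℝ) : ℝ := Δ * ((⌊x / Δ⌋ : ℝ) + 1 / 2)

/-- The uniform distribution on `[-Δ/2, Δ/2]`. -/
def uniformLaw (Δ : ℝ) : Measure ℝ :=
  ProbabilityTheory.cond volume (Set.Icc (-(Δ / 2)) (Δ / 2))

/-- The triangular dither distribution: the law of the sum of two independent random
variables, each uniform on `[-Δ/2, Δ/2]`. -/
def triangularLaw (Δ : ℝ) : Measure ℝ :=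
  ((uniformLaw Δ).prod (uniformLaw Δ)).map fun p => p.1 + p.2

/-- The averages `ȧ_s` of the products of the quantized data `y⁽¹⁾, …, y⁽ⁿ⁾` over all
samples and over all pairs in `R_s`. -/
def diagAverage {d n : ℕ} (R : Finset (Fin d)) (y : Fin n → Fin d → ℝ) (s : Fin d) : ℝ :=
  (1 / ((n : ℝ) * ((rulerPairs R s).card : ℝ))) *
    ∑ l : Fin n, ∑ p ∈ rulerPairs R s, y l p.1 * y l p.2

/-- The estimator `Toep(ȧ) - (Δ² / 4) I` computed from the quantized data. -/
def estimator {d n : ℕ} (Δ : ℝ) (R : Finset (Fin d)) (y : Fin n → Fin d → ℝ) :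
    Matrix (Fin d) (Fin d) ℝ :=
  toep (diagAverage R y) - (Δ ^ 2 / 4) • (1 : Matrix (Fin d) (Fin d) ℝ)

/-- The entrywise maximum norm of a matrix. -/
def maxNorm {d : ℕ} (M : Matrix (Fin d) (Fin d) ℝ) : ℝ :=
  ⨆ p : Fin d × Fin d, |M p.1 p.2|

/-- The operator norm of a matrix with respect to the Euclidean norm. -/
def opNorm {d : ℕ} (M : Matrix (Fin d) (Fin d) ℝ) : ℝ :=
  ‖Matrix.toEuclideanCLM (n := Fin d) (𝕜 := ℝ) M‖

/-- The sampling model: `x⁽¹⁾, …, x⁽ⁿ⁾` are i.i.d. with law `N(0, T)`, and the dithers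
`τ⁽ˡ⁾ᵢ` are i.i.d. triangular random variables, independent of the samples (equivalently: the
pairs `(x⁽ˡ⁾, τ⁽ˡ⁾)` are independent, and in each pair the vector `x⁽ˡ⁾` is independent of
`τ⁽ˡ⁾`, which has independent entries). -/
structure IsDitheredGaussianSample {Ω : Type*} [MeasurableSpace Ω] (P : Measure Ω) {d n : ℕ}
    (T : Matrix (Fin d) (Fin d) ℝ) (Δ : ℝ)
    (x : Fin n → Ω → EuclideanSpace ℝ (Fin d)) (τ : Fin n → Ω → Fin d → ℝ) : Prop where
  law_sample : ∀ l, HasLaw (x l) (multivariateGaussian 0 T) P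
  law_dither : ∀ l i, HasLaw (fun ω => τ l ω i) (triangularLaw Δ) P
  indep_across : iIndepFun (fun l ω => (x l ω, τ l ω)) P
  indep_sample_dither : ∀ l, IndepFun (x l) (τ l) P
  indep_dither : ∀ l, iIndepFun (fun i ω => τ l ω i) P

/-- The quantized data `ẋ⁽ˡ⁾ = Q_Δ(x⁽ˡ⁾ + τ⁽ˡ⁾)`, entry by entry. -/
def quantizedData {Ω : Type*} {d n : ℕ} (Δ : ℝ)
    (x : Fin n → Ω → EuclideanSpace ℝ (Fin d)) (τ : Fin n → Ω → Fin d → ℝ) (ω : Ω) :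
    Fin n → Fin d → ℝ :=
  fun l i => quantize Δ (x l ω i + τ l ω i)

/-- The scale `K = 2 (‖T‖₂ + 2 Δ²)`. -/
def scaleK {d : ℕ} (T : Matrix (Fin d) (Fin d) ℝ) (Δ : ℝ) : ℝ :=
  2 * (opNorm T + 2 * Δ ^ 2)

end QuantizedToeplitz

end

noncomputable section

namespace QuantizedToeplitz

/-! The triangular dither makes the first two moments of the quantizer exact: with `x` fixed, `ẋ_i`
has mean `x_i` and second moment `x_i² + Δ²/4`. As the dithers of distinct coordinates are
independent, `ẋ_j ẋ_k` has mean `T_jk`, plus `Δ²/4` when `j = k`, so the estimator is unbiased.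

For concentration, `|ẋ_i - x_i| ≤ 3Δ/2` bounds `ẋ_i²` by `2 x_i² + 9Δ²/2`, and squares of Gaussians
have exponential moments. An average over `R_s` is a convex combination of products, so Jensen's
inequality gives each centred average, divided by `4K`, an exponential absolute moment of at most 3,
whatever the dependence within a sample (`exp_abs_pairAverage_sub`). Bernstein's inequality over the
independent samples then bounds the deviation at each distance (`diagAverage_tail`).

A union bound over the `d ≤ |R|²` distances costs a factor `|R|²`; halving the exponent reduces it
to `|R|` (`maxNorm_tail`). -/

/-! ### Moments of the dithered quantizer -/

theorem measurable_quantize (Δ : ℝ) : Measurable (quantize Δ) := by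
  unfold quantize
  fun_prop

theorem abs_quantize_sub_le {Δ : ℝ} (hΔ : 0 < Δ) (y : ℝ) : |quantize Δ y - y| ≤ Δ / 2 := by
  have h1 := Int.floor_le (y / Δ)
  have h2 := Int.lt_floor_add_one (y / Δ)
  rw [le_div_iff₀ hΔ] at h1
  rw [div_lt_iff₀ hΔ] at h2
  unfold quantize
  rw [abs_le]
  constructor <;> nlinarith

theorem integral_uniformLaw {Δ : ℝ} (hΔ : 0 < Δ) (g : ℝ → ℝ) :
    ∫ u, g u ∂(uniformLaw Δ) = ∫ v in (-(1 / 2) : ℝ)..(1 / 2), g (Δ * v) := by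
  have hv : (volume (Set.Icc (-(Δ / 2)) (Δ / 2)))⁻¹.toReal = Δ⁻¹ := by
    rw [Real.volume_Icc, ENNReal.toReal_inv, ENNReal.toReal_ofReal (by linarith)]
    ring
  rw [uniformLaw, ProbabilityTheory.cond, integral_smul_measure, hv,
    integral_Icc_eq_integral_Ioc, ← intervalIntegral.integral_of_le (by linarith),
    intervalIntegral.integral_comp_mul_left _ hΔ.ne']
  congr 2 <;> ring

theorem isProbabilityMeasure_uniformLaw {Δ : ℝ} (hΔ : 0 < Δ) :
    IsProbabilityMeasure (uniformLaw Δ) := by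
  apply cond_isProbabilityMeasure_of_finite
  · rw [Real.volume_Icc, ne_eq, ENNReal.ofReal_eq_zero]
    linarith
  · exact measure_Icc_lt_top.ne

theorem isProbabilityMeasure_triangularLaw {Δ : ℝ} (hΔ : 0 < Δ) :
    IsProbabilityMeasure (triangularLaw Δ) := by
  have := isProbabilityMeasure_uniformLaw hΔ
  exact Measure.isProbabilityMeasure_map (by fun_prop)

theorem ae_abs_le_triangularLaw {Δ : ℝ} (hΔ : 0 < Δ) : ∀ᵐ t ∂(triangularLaw Δ), |t| ≤ Δ := by
  have := isProbabilityMeasure_uniformLaw hΔ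
  have h : ∀ᵐ u ∂(uniformLaw Δ), u ∈ Set.Icc (-(Δ / 2)) (Δ / 2) := ae_cond_mem measurableSet_Icc
  rw [triangularLaw, ae_map_iff (by fun_prop) (measurableSet_le (by fun_prop) (by fun_prop))]
  filter_upwards [Measure.quasiMeasurePreserving_fst.ae h,
    Measure.quasiMeasurePreserving_snd.ae h] with p h1 h2
  rw [Set.mem_Icc] at h1 h2
  rw [abs_le]
  constructor <;> linarith

theorem abs_quantize_add_le {Δ : ℝ} (hΔ : 0 < Δ) (y : ℝ) {t : ℝ} (ht : |t| ≤ Δ) :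
    |quantize Δ (y + t) - y| ≤ 3 / 2 * Δ := by
  have h := abs_quantize_sub_le hΔ (y + t)
  rw [abs_le] at *
  constructor <;> linarith

/-- The floor jumps once inside a unit interval, at `⌊b⌋ + 1`, which cuts it into lengths `1 - fract
b` and `fract b`. -/
theorem integral_floor_unit (G : ℤ → ℝ) (b : ℝ) :
    ∫ y in b..b + 1, G ⌊y⌋ = (1 - Int.fract b) * G ⌊b⌋ + Int.fract b * G (⌊b⌋ + 1) := by
  have h1 := Int.floor_le b
  have h2 := Int.lt_floor_add_one b
  have e1 : Set.EqOn (fun _ => G ⌊b⌋) (fun y : ℝ => G ⌊y⌋) (Set.Ioo b (⌊b⌋ + 1)) := by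
    intro y hy
    have : ⌊y⌋ = ⌊b⌋ := Int.floor_eq_iff.2 ⟨by linarith [hy.1], hy.2⟩
    simp [this]
  have e2 : Set.EqOn (fun _ => G (⌊b⌋ + 1)) (fun y : ℝ => G ⌊y⌋) (Set.Ioo (⌊b⌋ + 1) (b + 1)) := by
    intro y hy
    have : ⌊y⌋ = ⌊b⌋ + 1 :=
      Int.floor_eq_iff.2 ⟨by push_cast; linarith [hy.1], by push_cast; linarith [hy.2]⟩
    simp [this]
  have i1 : IntervalIntegrable (fun y : ℝ => G ⌊y⌋) volume b (⌊b⌋ + 1) :=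
    (intervalIntegrable_const (c := G ⌊b⌋)).congr_uIoo (by rwa [Set.uIoo_of_le h2.le])
  have i2 : IntervalIntegrable (fun y : ℝ => G ⌊y⌋) volume (⌊b⌋ + 1) (b + 1) :=
    (intervalIntegrable_const (c := G (⌊b⌋ + 1))).congr_uIoo
      (by rwa [Set.uIoo_of_le (by linarith)])
  rw [← intervalIntegral.integral_add_adjacent_intervals i1 i2,
    ← intervalIntegral.integral_congr_Ioo_of_le h2.le e1,
    ← intervalIntegral.integral_congr_Ioo_of_le (by linarith) e2,
    intervalIntegral.integral_const, intervalIntegral.integral_const, smul_eq_mul, smul_eq_mul,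
    ← Int.self_sub_floor]
  ring

theorem integral_floor_centered (G : ℤ → ℝ) (z : ℝ) :
    ∫ v in (-(1 / 2) : ℝ)..(1 / 2), G ⌊z + v⌋ =
      (1 - Int.fract (z - 1 / 2)) * G ⌊z - 1 / 2⌋ +
        Int.fract (z - 1 / 2) * G (⌊z - 1 / 2⌋ + 1) := by
  rw [← integral_floor_unit, intervalIntegral.integral_comp_add_left (fun y => G ⌊y⌋)]
  congr 1
  ring

/-- A uniform dither rounds `y` at random to one of two neighbouring output levels, with the weights
of linear interpolation. -/
theorem integral_quantize_uniformLaw {Δ : ℝ} (hΔ : 0 < Δ) (y : ℝ) :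
    ∫ u, quantize Δ (y + u) ∂(uniformLaw Δ) = y := by
  have h := integral_floor_centered (fun m => Δ * ((m : ℝ) + 1 / 2)) (y / Δ)
  rw [integral_uniformLaw hΔ]
  have e (v : ℝ) : quantize Δ (y + Δ * v) = Δ * ((⌊y / Δ + v⌋ : ℝ) + 1 / 2) := by
    rw [quantize, add_div, mul_div_cancel_left₀ _ hΔ.ne']
  simp_rw [e, h, ← Int.self_sub_floor]
  push_cast
  field_simp
  ring

/-- The extra term is the variance of a two-point law on levels `Δ` apart. It still depends on `y`,
which is what the second uniform summand of the dither removes. -/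
theorem integral_quantize_sq_uniformLaw {Δ : ℝ} (hΔ : 0 < Δ) (y : ℝ) :
    ∫ u, quantize Δ (y + u) ^ 2 ∂(uniformLaw Δ) =
      y ^ 2 + Δ ^ 2 * (Int.fract (y / Δ - 1 / 2) * (1 - Int.fract (y / Δ - 1 / 2))) := by
  have h := integral_floor_centered (fun m => (Δ * ((m : ℝ) + 1 / 2)) ^ 2) (y / Δ)
  rw [integral_uniformLaw hΔ]
  have e (v : ℝ) : quantize Δ (y + Δ * v) = Δ * ((⌊y / Δ + v⌋ : ℝ) + 1 / 2) := by
    rw [quantize, add_div, mul_div_cancel_left₀ _ hΔ.ne']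
  simp_rw [e, h, ← Int.self_sub_floor]
  push_cast
  field_simp
  ring

theorem integral_fract_mul_one_sub_fract (z : ℝ) :
    ∫ v in z..z + 1, Int.fract v * (1 - Int.fract v) = 1 / 6 := by
  have hp : Function.Periodic (fun v : ℝ => Int.fract v * (1 - Int.fract v)) 1 := fun v => by simp
  rw [hp.intervalIntegral_add_eq z 0, zero_add]
  rw [intervalIntegral.integral_congr_Ioo_of_le (g := fun v : ℝ => v - v ^ 2) zero_le_one]
  · rw [intervalIntegral.integral_sub (by simp) (by simp)]
    norm_num
  · intro v hv
    have : Int.fract v = v := Int.fract_eq_self.2 ⟨hv.1.le, hv.2⟩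
    simp only [this]
    ring

theorem memLp_quantize_triangularLaw {Δ : ℝ} (hΔ : 0 < Δ) (y : ℝ) :
    MemLp (fun t => quantize Δ (y + t)) 2 (triangularLaw Δ) := by
  have := isProbabilityMeasure_triangularLaw hΔ
  refine MemLp.of_bound ((measurable_quantize Δ).comp (by fun_prop)).aestronglyMeasurable
    (|y| + 3 / 2 * Δ) ?_
  filter_upwards [ae_abs_le_triangularLaw hΔ] with t ht
  have h := abs_quantize_add_le hΔ y ht
  have h2 := abs_sub_abs_le_abs_sub (quantize Δ (y + t)) y
  rw [Real.norm_eq_abs]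
  linarith

theorem integral_triangularLaw {Δ : ℝ} (hΔ : 0 < Δ) {g : ℝ → ℝ}
    (hg : Integrable g (triangularLaw Δ)) :
    ∫ t, g t ∂(triangularLaw Δ) = ∫ u, ∫ v, g (u + v) ∂(uniformLaw Δ) ∂(uniformLaw Δ) := by
  have := isProbabilityMeasure_uniformLaw hΔ
  have hm : Measurable fun p : ℝ × ℝ => p.1 + p.2 := by fun_prop
  have hg' := hg
  rw [triangularLaw] at hg
  rw [triangularLaw, integral_map hm.aemeasurable hg.aestronglyMeasurable, integral_prod]
  exact (integrable_map_measure hg.aestronglyMeasurable hm.aemeasurable).1 hg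

theorem integral_quantize_triangularLaw {Δ : ℝ} (hΔ : 0 < Δ) (y : ℝ) :
    ∫ t, quantize Δ (y + t) ∂(triangularLaw Δ) = y := by
  have := isProbabilityMeasure_triangularLaw hΔ
  rw [integral_triangularLaw hΔ ((memLp_quantize_triangularLaw hΔ y).integrable one_le_two)]
  simp_rw [← add_assoc, integral_quantize_uniformLaw hΔ]
  rw [integral_uniformLaw hΔ, intervalIntegral.integral_add (by simp)
    (Continuous.intervalIntegrable (by fun_prop) _ _), intervalIntegral.integral_const_mul]
  norm_num

/-- One uniform summand acts as the dither; averaging over the other turns `fract * (1 - fract)`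
into its mean `1/6` over a period and adds its own variance `Δ²/12`. Indeed `1/6 + 1/12 = 1/4`. -/
theorem integral_quantize_sq_triangularLaw {Δ : ℝ} (hΔ : 0 < Δ) (y : ℝ) :
    ∫ t, quantize Δ (y + t) ^ 2 ∂(triangularLaw Δ) = y ^ 2 + Δ ^ 2 / 4 := by
  rw [integral_triangularLaw hΔ (memLp_quantize_triangularLaw hΔ y).integrable_sq]
  simp_rw [← add_assoc, integral_quantize_sq_uniformLaw hΔ]
  rw [integral_uniformLaw hΔ]
  have e (v : ℝ) : (y + Δ * v) / Δ - 1 / 2 = (y / Δ - 1 / 2) + v := by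
    field_simp
    ring
  simp_rw [e]
  have hi : IntervalIntegrable (fun v : ℝ => Δ ^ 2 * (Int.fract (y / Δ - 1 / 2 + v) *
      (1 - Int.fract (y / Δ - 1 / 2 + v)))) volume (-(1 / 2)) (1 / 2) := by
    refine (intervalIntegrable_const (c := Δ ^ 2)).mono_fun
      (Measurable.aestronglyMeasurable (by fun_prop)) (ae_of_all _ fun v => ?_)
    have h0 := Int.fract_nonneg (y / Δ - 1 / 2 + v)
    have h1 := (Int.fract_lt_one (y / Δ - 1 / 2 + v)).le
    have h2 := mul_nonneg (sq_nonneg Δ) (mul_nonneg h0 (sub_nonneg.2 h1))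
    have h3 : (0 : ℝ) ≤ Δ ^ 2 := sq_nonneg Δ
    simp only [Real.norm_of_nonneg h2, Real.norm_of_nonneg h3]
    exact mul_le_of_le_one_right (sq_nonneg Δ) (by nlinarith)
  rw [intervalIntegral.integral_add (Continuous.intervalIntegrable (by fun_prop) _ _) hi,
    intervalIntegral.integral_const_mul,
    intervalIntegral.integral_comp_add_left (fun w => Int.fract w * (1 - Int.fract w))]
  have h := integral_fract_mul_one_sub_fract (y / Δ - 1 / 2 + -(1 / 2))
  rw [show y / Δ - 1 / 2 + -(1 / 2) + 1 = y / Δ - 1 / 2 + 1 / 2 by ring] at h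
  rw [h]
  have h2 : ∫ v in (-(1 / 2) : ℝ)..(1 / 2), (y + Δ * v) ^ 2 = y ^ 2 + Δ ^ 2 / 12 := by
    have e2 (v : ℝ) : (y + Δ * v) ^ 2 = y ^ 2 + 2 * y * Δ * v + Δ ^ 2 * v ^ 2 := by ring
    simp_rw [e2]
    rw [intervalIntegral.integral_add (Continuous.intervalIntegrable (by fun_prop) _ _)
      (Continuous.intervalIntegrable (by fun_prop) _ _),
      intervalIntegral.integral_add (Continuous.intervalIntegrable (by fun_prop) _ _)
      (Continuous.intervalIntegrable (by fun_prop) _ _), intervalIntegral.integral_const_mul,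
      intervalIntegral.integral_const_mul]
    norm_num
    ring
  rw [h2]
  ring

/-! ### Bernstein's inequality from exponential moments -/

theorem exp_le_one_add_add_sq_mul (x : ℝ) : Real.exp x ≤ 1 + x + x ^ 2 * Real.exp |x| := by
  have h := Complex.norm_exp_sub_sum_le_norm_mul_exp (x : ℂ) 2
  simp only [Finset.sum_range_succ, Finset.sum_range_zero, pow_zero, pow_one, Nat.factorial,
    Nat.cast_one, div_one, zero_add, mul_one] at h
  rw [← Complex.ofReal_exp, ← Complex.ofReal_one, ← Complex.ofReal_add, ← Complex.ofReal_sub,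
    Complex.norm_real, Complex.norm_real, Real.norm_eq_abs, Real.norm_eq_abs, sq_abs] at h
  linarith [le_abs_self (Real.exp x - (1 + x))]

/-- Half of the exponent `|z|` dominates `|η z|`; the other half absorbs `z²`, at the price of the
factor 8. -/
theorem exp_mul_le_of_abs_le_half {η : ℝ} (hη : |η| ≤ 1 / 2) (z : ℝ) :
    Real.exp (η * z) ≤ 1 + η * z + 8 * η ^ 2 * Real.exp |z| := by
  have h1 := exp_le_one_add_add_sq_mul (η * z)
  have h2 : Real.exp |η * z| ≤ Real.exp (|z| / 2) := by
    rw [abs_mul]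
    exact Real.exp_le_exp.2 (by nlinarith [abs_nonneg z])
  have h3 : z ^ 2 ≤ 8 * Real.exp (|z| / 2) := by
    have := Real.quadratic_le_exp_of_nonneg (x := |z| / 2) (by positivity)
    rw [← sq_abs]
    nlinarith [abs_nonneg z]
  have h4 : Real.exp |z| = Real.exp (|z| / 2) * Real.exp (|z| / 2) := by
    rw [← Real.exp_add]
    ring_nf
  have h5 : z ^ 2 * Real.exp |η * z| ≤ 8 * Real.exp (|z| / 2) * Real.exp (|z| / 2) := by gcongr
  have h6 := mul_le_mul_of_nonneg_left h5 (sq_nonneg η)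
  rw [h4]
  linarith

section Bernstein

variable {Ω : Type*} [MeasurableSpace Ω] {P : Measure Ω}

theorem integrable_of_integrable_exp_abs {Y : Ω → ℝ} (hm : AEMeasurable Y P)
    (hi : Integrable (fun ω => Real.exp |Y ω|) P) : Integrable Y P := by
  refine hi.mono' hm.aestronglyMeasurable (ae_of_all _ fun ω => ?_)
  rw [Real.norm_eq_abs]
  linarith [Real.add_one_le_exp |Y ω|]

theorem integrable_exp_mul_of_integrable_exp_abs {Y : Ω → ℝ} (hm : AEMeasurable Y P)
    (hi : Integrable (fun ω => Real.exp |Y ω|) P) {η : ℝ} (hη : |η| ≤ 1) :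
    Integrable (fun ω => Real.exp (η * Y ω)) P := by
  refine hi.mono' (by fun_prop) (ae_of_all _ fun ω => ?_)
  rw [Real.norm_eq_abs, Real.abs_exp, Real.exp_le_exp]
  have h := le_abs_self (η * Y ω)
  rw [abs_mul] at h
  nlinarith [abs_nonneg (Y ω)]

variable [IsProbabilityMeasure P]

/-- Centring kills the linear term of the expansion, and `1 + u ≤ exp u` does the rest. -/
theorem mgf_le_exp_of_integral_exp_abs_le {Y : Ω → ℝ} {M : ℝ} (hm : AEMeasurable Y P)
    (h0 : ∫ ω, Y ω ∂P = 0) (hi : Integrable (fun ω => Real.exp |Y ω|) P)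
    (hM : ∫ ω, Real.exp |Y ω| ∂P ≤ M) {η : ℝ} (hη : |η| ≤ 1 / 2) :
    mgf Y P η ≤ Real.exp (8 * M * η ^ 2) := by
  have hY := integrable_of_integrable_exp_abs hm hi
  have hlin : Integrable (fun ω => 1 + η * Y ω) P := (integrable_const 1).add (hY.const_mul η)
  have hexp : Integrable (fun ω => 8 * η ^ 2 * Real.exp |Y ω|) P := hi.const_mul _
  have h : mgf Y P η ≤ ∫ ω, (1 + η * Y ω + 8 * η ^ 2 * Real.exp |Y ω|) ∂P :=
    integral_mono (integrable_exp_mul_of_integrable_exp_abs hm hi (by linarith))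
      (hlin.add hexp) fun ω => exp_mul_le_of_abs_le_half hη (Y ω)
  rw [integral_add hlin hexp, integral_add (integrable_const 1) (hY.const_mul η),
    integral_const_mul, integral_const_mul, h0] at h
  simp only [integral_const, probReal_univ, smul_eq_mul, mul_one, mul_zero, add_zero] at h
  have h2 : 8 * η ^ 2 * ∫ ω, Real.exp |Y ω| ∂P ≤ 8 * η ^ 2 * M := by gcongr
  have h3 := Real.add_one_le_exp (8 * M * η ^ 2)
  linarith

/-- Bernstein's inequality for independent centred sub-exponential random variables. -/
theorem bernstein_upper {n : ℕ} {Y : Fin n → Ω → ℝ} {M : ℝ} (hM1 : 1 ≤ M)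
    (hind : iIndepFun Y P) (hm : ∀ l, AEMeasurable (Y l) P) (h0 : ∀ l, ∫ ω, Y l ω ∂P = 0)
    (hi : ∀ l, Integrable (fun ω => Real.exp |Y l ω|) P)
    (hM : ∀ l, ∫ ω, Real.exp |Y l ω| ∂P ≤ M) {s : ℝ} (hs : 0 ≤ s) :
    P.real {ω | n * s ≤ ∑ l, Y l ω} ≤ Real.exp (-(n * min (s ^ 2) s / (32 * M))) := by
  have hMpos : 0 < M := by linarith
  -- Chernoff's exponent `-η s + 8 M η²` is minimal at `η = s / (16 M)`. Truncating `s` at 1 keeps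
  -- `η ≤ 1/2`, since `M ≥ 1`, and yields the linear regime of the minimum.
  set q := min 1 s with hq
  have hq0 : 0 ≤ q := le_min zero_le_one hs
  have hq1 : q ≤ 1 := min_le_left _ _
  have hqs : q ≤ s := min_le_right _ _
  have hmin : min (s ^ 2) s = s * q := by
    rw [hq, mul_min_of_nonneg _ _ hs, mul_one, min_comm, sq]
  have hη0 : 0 ≤ q / (16 * M) := by positivity
  have hη : |q / (16 * M)| ≤ 1 / 2 := by
    rw [abs_of_nonneg hη0, div_le_iff₀ (by positivity)]
    linarith
  have hint : Integrable (fun ω => Real.exp (q / (16 * M) * (∑ l, Y l) ω)) P := by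
    -- Without integrability the `mgf` of the sum takes the default value 0, yet it equals a product
    -- of positive factors.
    by_contra hcon
    have h1 := hind.mgf_sum₀ (t := q / (16 * M)) hm Finset.univ
    have h2 : mgf (∑ l, Y l) P (q / (16 * M)) = 0 := mgf_undef hcon
    rw [h2] at h1
    have h3 : 0 < ∏ l, mgf (Y l) P (q / (16 * M)) := Finset.prod_pos fun l _ =>
      mgf_pos (integrable_exp_mul_of_integrable_exp_abs (hm l) (hi l) (by linarith))
    linarith
  have h := measure_ge_le_exp_mul_mgf (n * s) hη0 hint
  simp only [Finset.sum_apply] at h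
  refine h.trans ?_
  rw [hind.mgf_sum₀ hm]
  have hprod : ∏ l, mgf (Y l) P (q / (16 * M)) ≤
      ∏ _l : Fin n, Real.exp (8 * M * (q / (16 * M)) ^ 2) :=
    Finset.prod_le_prod (fun l _ => mgf_nonneg) fun l _ =>
      mgf_le_exp_of_integral_exp_abs_le (hm l) (h0 l) (hi l) (hM l) hη
  rw [Finset.prod_const, Finset.card_univ, Fintype.card_fin, ← Real.exp_nat_mul] at hprod
  refine (mul_le_mul_of_nonneg_left hprod (Real.exp_pos _).le).trans ?_
  rw [← Real.exp_add, Real.exp_le_exp, hmin]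
  have e : -(q / (16 * M)) * (n * s) + n * (8 * M * (q / (16 * M)) ^ 2) =
      -(n * (s * q) / (32 * M)) - n * q * (s - q) / (32 * M) := by
    field_simp
    ring
  rw [e]
  have : 0 ≤ n * q * (s - q) / (32 * M) :=
    div_nonneg (mul_nonneg (by positivity) (by linarith)) (by positivity)
  linarith

theorem bernstein {n : ℕ} {Y : Fin n → Ω → ℝ} {M : ℝ} (hM1 : 1 ≤ M)
    (hind : iIndepFun Y P) (hm : ∀ l, AEMeasurable (Y l) P) (h0 : ∀ l, ∫ ω, Y l ω ∂P = 0)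
    (hi : ∀ l, Integrable (fun ω => Real.exp |Y l ω|) P)
    (hM : ∀ l, ∫ ω, Real.exp |Y l ω| ∂P ≤ M) {s : ℝ} (hs : 0 ≤ s) :
    P.real {ω | n * s ≤ |∑ l, Y l ω|} ≤ 2 * Real.exp (-(n * min (s ^ 2) s / (32 * M))) := by
  have h1 := bernstein_upper hM1 hind hm h0 hi hM hs
  have h2 := bernstein_upper (Y := fun l ω => -Y l ω) hM1
    (hind.comp (fun _ y => -y) fun _ => measurable_neg) (fun l => (hm l).neg)
    (fun l => by rw [integral_neg, h0, neg_zero]) (by simpa using hi) (by simpa using hM) hs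
  have hsub : {ω | n * s ≤ |∑ l, Y l ω|} ⊆
      {ω | n * s ≤ ∑ l, Y l ω} ∪ {ω | n * s ≤ ∑ l, -Y l ω} := by
    intro ω hω
    rw [Set.mem_ofPred_eq, le_abs] at hω
    simpa [Finset.sum_neg_distrib] using hω
  linarith [measureReal_mono (μ := P) hsub, measureReal_union_le (μ := P)
    {ω | n * s ≤ ∑ l, Y l ω} {ω | n * s ≤ ∑ l, -Y l ω}]

end Bernstein

/-! ### Exponential moments of Gaussian squares -/

theorem integrable_exp_sq_div_four_gaussianReal :
    Integrable (fun x : ℝ => Real.exp (x ^ 2 / 4)) (gaussianReal 0 1) := by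
  rw [gaussianReal_of_var_ne_zero _ one_ne_zero,
    integrable_withDensity_iff (measurable_gaussianPDF _ _) (ae_of_all _ fun x => gaussianPDF_lt_top)]
  have h := (integrable_exp_neg_mul_sq (b := 1 / 4) (by norm_num)).const_mul (√(2 * Real.pi))⁻¹
  refine h.congr (ae_of_all _ fun x => ?_)
  simp only [toReal_gaussianPDF, gaussianPDFReal, NNReal.coe_one, mul_one, sub_zero]
  rw [mul_comm (Real.exp (x ^ 2 / 4)), mul_assoc, ← Real.exp_add]
  ring_nf

theorem integral_exp_sq_div_four_gaussianReal :
    ∫ x : ℝ, Real.exp (x ^ 2 / 4) ∂(gaussianReal 0 1) = √2 := by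
  rw [integral_gaussianReal_eq_integral_smul one_ne_zero]
  have e (x : ℝ) : gaussianPDFReal 0 1 x • Real.exp (x ^ 2 / 4) =
      (√(2 * Real.pi))⁻¹ * Real.exp (-(1 / 4) * x ^ 2) := by
    simp only [gaussianPDFReal, NNReal.coe_one, mul_one, sub_zero, smul_eq_mul]
    rw [mul_assoc, ← Real.exp_add]
    ring_nf
  simp_rw [e]
  rw [integral_const_mul, integral_gaussian, ← Real.sqrt_inv, ← Real.sqrt_mul (by positivity)]
  congr 1
  field_simp
  norm_num

/-- Writing the variable as `√v` times a standard Gaussian reduces to the weight `1/4` and also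
covers the degenerate case `v = 0`. -/
theorem exp_mul_sq_gaussianReal {v : NNReal} {a : ℝ} (ha : a * v ≤ 1 / 4) :
    Integrable (fun x : ℝ => Real.exp (a * x ^ 2)) (gaussianReal 0 v) ∧
      ∫ x, Real.exp (a * x ^ 2) ∂(gaussianReal 0 v) ≤ √2 := by
  have hmap : (gaussianReal 0 1).map (√v * ·) = gaussianReal 0 v := by
    rw [gaussianReal_map_const_mul]
    congr 1
    · simp
    · ext
      simp
  have hle (x : ℝ) : Real.exp (a * (√v * x) ^ 2) ≤ Real.exp (x ^ 2 / 4) := by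
    rw [mul_pow, Real.sq_sqrt v.coe_nonneg, ← mul_assoc, Real.exp_le_exp]
    nlinarith [sq_nonneg x]
  have hint : Integrable (fun x : ℝ => Real.exp (a * (√v * x) ^ 2)) (gaussianReal 0 1) := by
    refine integrable_exp_sq_div_four_gaussianReal.mono' (by fun_prop) (ae_of_all _ fun x => ?_)
    rw [Real.norm_eq_abs, Real.abs_exp]
    exact hle x
  rw [← hmap]
  constructor
  · rw [integrable_map_measure (by fun_prop) (by fun_prop)]
    exact hint
  · rw [integral_map (by fun_prop) (by fun_prop), ← integral_exp_sq_div_four_gaussianReal]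
    exact integral_mono hint integrable_exp_sq_div_four_gaussianReal hle

theorem abs_entry_le_opNorm {d : ℕ} (T : Matrix (Fin d) (Fin d) ℝ) (j k : Fin d) :
    |T j k| ≤ opNorm T := by
  have h1 := (Matrix.toEuclideanCLM (n := Fin d) (𝕜 := ℝ) T).le_opNorm (EuclideanSpace.single k 1)
  rw [PiLp.norm_single, norm_one, mul_one] at h1
  have h2 := PiLp.norm_apply_le
    (Matrix.toEuclideanCLM (n := Fin d) (𝕜 := ℝ) T (EuclideanSpace.single k 1)) j
  have h3 : Matrix.toEuclideanCLM (n := Fin d) (𝕜 := ℝ) T (EuclideanSpace.single k 1) j = T j k := by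
    simp
  rw [h3, Real.norm_eq_abs] at h2
  exact h2.trans h1

/-! ### Moments of the quantized data -/

section Model

variable {Ω : Type*} [MeasurableSpace Ω] {P : Measure Ω} {d n : ℕ}
  {T : Matrix (Fin d) (Fin d) ℝ} {Δ : ℝ} {x : Fin n → Ω → EuclideanSpace ℝ (Fin d)}
  {τ : Fin n → Ω → Fin d → ℝ}

theorem IsDitheredGaussianSample.aemeasurable_sample (h : IsDitheredGaussianSample P T Δ x τ)
    (l : Fin n) : AEMeasurable (x l) P := (h.law_sample l).aemeasurable

theorem IsDitheredGaussianSample.aemeasurable_quantizedData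
    (h : IsDitheredGaussianSample P T Δ x τ) (l : Fin n) (i : Fin d) :
    AEMeasurable (fun ω => quantizedData Δ x τ ω l i) P := by
  have hx := h.aemeasurable_sample l
  have hτ := (h.law_dither l i).aemeasurable
  exact (measurable_quantize Δ).comp_aemeasurable (by fun_prop)

theorem IsDitheredGaussianSample.ae_quantizedData_sq_le (h : IsDitheredGaussianSample P T Δ x τ)
    (hΔ : 0 < Δ) (l : Fin n) :
    ∀ᵐ ω ∂P, ∀ i, quantizedData Δ x τ ω l i ^ 2 ≤ 2 * x l ω i ^ 2 + 9 / 2 * Δ ^ 2 := by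
  rw [ae_all_iff]
  intro i
  have h1 : ∀ᵐ ω ∂P, |τ l ω i| ≤ Δ := by
    have ha := ae_abs_le_triangularLaw hΔ
    rw [← (h.law_dither l i).map_eq] at ha
    exact ae_of_ae_map (h.law_dither l i).aemeasurable ha
  filter_upwards [h1] with ω hω
  have h2 := sq_le_sq' (abs_le.1 (abs_quantize_add_le hΔ (x l ω i) hω)).1
    (abs_le.1 (abs_quantize_add_le hΔ (x l ω i) hω)).2
  rw [quantizedData]
  -- With `q` the quantized value, `2 x² + 2 (q - x)² - q² = (q - 2 x)²`.
  nlinarith [sq_nonneg (quantize Δ (x l ω i + τ l ω i) - 2 * x l ω i)]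

theorem IsDitheredGaussianSample.hasLaw_coord (h : IsDitheredGaussianSample P T Δ x τ)
    (hT : T.PosSemidef) (l : Fin n) (i : Fin d) :
    HasLaw (fun ω => x l ω i) (gaussianReal 0 (T i i).toNNReal) P :=
  (measurePreserving_eval_multivariateGaussian (μ := 0) hT (i := i)).hasLaw.comp
    (h.law_sample l)

theorem IsDitheredGaussianSample.exp_mul_sq_coord (h : IsDitheredGaussianSample P T Δ x τ)
    (hT : T.PosSemidef) (l : Fin n) (i : Fin d) {a : ℝ} (ha : a * T i i ≤ 1 / 4) :
    Integrable (fun ω => Real.exp (a * x l ω i ^ 2)) P ∧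
      ∫ ω, Real.exp (a * x l ω i ^ 2) ∂P ≤ √2 := by
  have hlaw := h.hasLaw_coord hT l i
  have hg := exp_mul_sq_gaussianReal (v := (T i i).toNNReal) (a := a)
    (by rwa [Real.coe_toNNReal _ hT.diag_nonneg])
  have hm : Measurable fun y : ℝ => Real.exp (a * y ^ 2) := by fun_prop
  rw [← hlaw.map_eq, integrable_map_measure hm.aestronglyMeasurable hlaw.aemeasurable,
    integral_map hlaw.aemeasurable hm.aestronglyMeasurable] at hg
  exact hg

theorem IsDitheredGaussianSample.memLp_coord (h : IsDitheredGaussianSample P T Δ x τ)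
    (hT : T.PosSemidef) (l : Fin n) (i : Fin d) : MemLp (fun ω => x l ω i) 2 P := by
  have hlaw := h.hasLaw_coord hT l i
  have hg : MemLp id 2 (gaussianReal 0 (T i i).toNNReal) := memLp_id_gaussianReal 2
  rw [← hlaw.map_eq] at hg
  exact hg.comp_of_map hlaw.aemeasurable

variable [IsProbabilityMeasure P]

theorem IsDitheredGaussianSample.memLp_quantizedData (h : IsDitheredGaussianSample P T Δ x τ)
    (hT : T.PosSemidef) (hΔ : 0 < Δ) (l : Fin n) (i : Fin d) :
    MemLp (fun ω => quantizedData Δ x τ ω l i) 2 P := by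
  rw [memLp_two_iff_integrable_sq (h.aemeasurable_quantizedData l i).aestronglyMeasurable]
  refine (((h.memLp_coord hT l i).integrable_sq.const_mul 2).add
    (integrable_const (9 / 2 * Δ ^ 2))).mono'
    ((h.aemeasurable_quantizedData l i).pow_const 2).aestronglyMeasurable ?_
  filter_upwards [h.ae_quantizedData_sq_le hΔ l] with ω hω
  rw [Real.norm_of_nonneg (sq_nonneg _)]
  exact hω i

theorem integral_coord_mul_coord (hT : T.PosSemidef) (j k : Fin d) :
    ∫ y : EuclideanSpace ℝ (Fin d), y j * y k ∂(multivariateGaussian 0 T) = T j k := by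
  have hL (i : Fin d) : MemLp (fun y : EuclideanSpace ℝ (Fin d) => y i) 2
      (multivariateGaussian 0 T) :=
    (memLp_id_gaussianReal 2).comp_measurePreserving
      (measurePreserving_eval_multivariateGaussian (μ := 0) hT (i := i))
  have h0 (i : Fin d) : ∫ y : EuclideanSpace ℝ (Fin d), y i ∂(multivariateGaussian 0 T) = 0 := by
    have hp := measurePreserving_eval_multivariateGaussian (μ := 0) hT (i := i)
    have := integral_map (μ := multivariateGaussian 0 T) (f := id) hp.measurable.aemeasurable (by fun_prop)
    rw [hp.map_eq] at this
    simpa using this.symm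
  have h := covariance_eval_multivariateGaussian (μ := 0) hT j k
  rw [covariance_eq_sub (hL j) (hL k), h0, h0, mul_zero, sub_zero] at h
  exact h

theorem integral_quantizedData_sq (h : IsDitheredGaussianSample P T Δ x τ)
    (hT : T.PosSemidef) (hΔ : 0 < Δ) (l : Fin n) (i : Fin d) :
    ∫ ω, quantizedData Δ x τ ω l i ^ 2 ∂P = T i i + Δ ^ 2 / 4 := by
  have := isProbabilityMeasure_triangularLaw hΔ
  have hν := h.law_dither l i
  have hind : IndepFun (x l) (fun ω => τ l ω i) P :=
    (h.indep_sample_dither l).comp measurable_id (measurable_pi_apply i)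
  have hlaw := (indepFun_iff_map_prod_eq_prod_map_map (h.aemeasurable_sample l)
    hν.aemeasurable).1 hind
  rw [(h.law_sample l).map_eq, hν.map_eq] at hlaw
  have hae := (h.aemeasurable_sample l).prodMk hν.aemeasurable
  let g : EuclideanSpace ℝ (Fin d) × ℝ → ℝ := fun p => quantize Δ (p.1 i + p.2) ^ 2
  have hg : Measurable g := ((measurable_quantize Δ).comp (by fun_prop)).pow_const 2
  have hint : Integrable g ((multivariateGaussian 0 T).prod (triangularLaw Δ)) := by
    rw [← hlaw, integrable_map_measure hg.aestronglyMeasurable hae]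
    exact (h.memLp_quantizedData hT hΔ l i).integrable_sq
  calc ∫ ω, quantizedData Δ x τ ω l i ^ 2 ∂P
      = ∫ p, g p ∂((multivariateGaussian 0 T).prod (triangularLaw Δ)) := by
        rw [← hlaw, integral_map hae hg.aestronglyMeasurable]
        rfl
    _ = ∫ y : EuclideanSpace ℝ (Fin d), (y i ^ 2 + Δ ^ 2 / 4) ∂(multivariateGaussian 0 T) := by
        rw [integral_prod _ hint]
        simp only [g, integral_quantize_sq_triangularLaw hΔ]
    _ = T i i + Δ ^ 2 / 4 := by
        have hL : MemLp (fun y : EuclideanSpace ℝ (Fin d) => y i) 2 (multivariateGaussian 0 T) :=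
          (memLp_id_gaussianReal 2).comp_measurePreserving
            (measurePreserving_eval_multivariateGaussian (μ := 0) hT (i := i))
        have h2 := integral_coord_mul_coord hT i i
        simp only [← sq] at h2
        rw [integral_add hL.integrable_sq (integrable_const _), h2]
        simp

/-- The sample and the two dithers have a product law. For a fixed sample `y`, the integral over the
dithers factors into two unbiased quantizations, leaving `y j * y k`. -/
theorem integral_quantizedData_mul_of_ne (h : IsDitheredGaussianSample P T Δ x τ)
    (hT : T.PosSemidef) (hΔ : 0 < Δ) (l : Fin n) {j k : Fin d} (hjk : j ≠ k) :
    ∫ ω, quantizedData Δ x τ ω l j * quantizedData Δ x τ ω l k ∂P = T j k := by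
  have := isProbabilityMeasure_triangularLaw hΔ
  have hj := h.law_dither l j
  have hk := h.law_dither l k
  have hτ := (indepFun_iff_map_prod_eq_prod_map_map hj.aemeasurable hk.aemeasurable).1
    ((h.indep_dither l).indepFun hjk)
  rw [hj.map_eq, hk.map_eq] at hτ
  have hind : IndepFun (x l) (fun ω => (τ l ω j, τ l ω k)) P :=
    (h.indep_sample_dither l).comp (φ := id) (ψ := fun t : Fin d → ℝ => (t j, t k))
      measurable_id (by fun_prop)
  have hjk' := hj.aemeasurable.prodMk hk.aemeasurable
  have hlaw := (indepFun_iff_map_prod_eq_prod_map_map (h.aemeasurable_sample l) hjk').1 hind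
  rw [(h.law_sample l).map_eq, hτ] at hlaw
  have hae := (h.aemeasurable_sample l).prodMk hjk'
  let g : EuclideanSpace ℝ (Fin d) × ℝ × ℝ → ℝ := fun p =>
    quantize Δ (p.1 j + p.2.1) * quantize Δ (p.1 k + p.2.2)
  have hg : Measurable g := ((measurable_quantize Δ).comp (by fun_prop)).mul
    ((measurable_quantize Δ).comp (by fun_prop))
  have hint : Integrable g
      ((multivariateGaussian 0 T).prod ((triangularLaw Δ).prod (triangularLaw Δ))) := by
    rw [← hlaw, integrable_map_measure hg.aestronglyMeasurable hae]
    exact (h.memLp_quantizedData hT hΔ l j).integrable_mul (h.memLp_quantizedData hT hΔ l k)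
  calc ∫ ω, quantizedData Δ x τ ω l j * quantizedData Δ x τ ω l k ∂P
      = ∫ p, g p ∂((multivariateGaussian 0 T).prod
          ((triangularLaw Δ).prod (triangularLaw Δ))) := by
        rw [← hlaw, integral_map hae hg.aestronglyMeasurable]
        rfl
    _ = ∫ y : EuclideanSpace ℝ (Fin d), y j * y k ∂(multivariateGaussian 0 T) := by
        rw [integral_prod _ hint]
        refine integral_congr_ae (ae_of_all _ fun y => ?_)
        have := integral_prod_mul (μ := triangularLaw Δ) (ν := triangularLaw Δ)
          (fun s => quantize Δ (y j + s)) (fun t => quantize Δ (y k + t))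
        rwa [integral_quantize_triangularLaw hΔ, integral_quantize_triangularLaw hΔ] at this
    _ = T j k := integral_coord_mul_coord hT j k

end Model

/-! ### Ruler averages and the scale `K` -/

/-- The expectation of `diagAverage` at the distance `s`. -/
def diagMean {d : ℕ} (a : Fin d → ℝ) (Δ : ℝ) (s : Fin d) : ℝ :=
  a s + if (s : ℕ) = 0 then Δ ^ 2 / 4 else 0

/-- The average of `y j * y k` over the pairs `(j, k)` of the ruler at distance `s`. -/
def pairAverage {d : ℕ} (R : Finset (Fin d)) (s : Fin d) (y : Fin d → ℝ) : ℝ :=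
  ∑ p ∈ rulerPairs R s, ((rulerPairs R s).card : ℝ)⁻¹ * (y p.1 * y p.2)

theorem measurable_pairAverage {d : ℕ} (R : Finset (Fin d)) (s : Fin d) :
    Measurable (pairAverage R s) := by
  unfold pairAverage
  fun_prop

theorem indexDist_eq_zero_iff {d : ℕ} (j k : Fin d) : (indexDist j k : ℕ) = 0 ↔ j = k := by
  rw [indexDist, Fin.ext_iff]
  exact ⟨Nat.eq_of_dist_eq_zero, Nat.dist_eq_zero⟩

theorem IsRuler.rulerPairs_nonempty {d : ℕ} {R : Finset (Fin d)} (hR : IsRuler R) (s : Fin d) :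
    (rulerPairs R s).Nonempty := by
  obtain ⟨j, hj, k, hk, h⟩ := hR s
  exact ⟨(j, k), by simp [rulerPairs, hj, hk, h]⟩

theorem IsRuler.le_card_sq {d : ℕ} {R : Finset (Fin d)} (hR : IsRuler R) : d ≤ R.card ^ 2 := by
  have h : (Finset.univ : Finset (Fin d)) ⊆ (R ×ˢ R).image fun p => indexDist p.1 p.2 := by
    intro s _
    obtain ⟨j, hj, k, hk, h⟩ := hR s
    exact Finset.mem_image.2 ⟨(j, k), Finset.mk_mem_product hj hk, h⟩
  have h2 := (Finset.card_le_card h).trans Finset.card_image_le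
  rwa [Finset.card_univ, Fintype.card_fin, Finset.card_product, ← sq] at h2

theorem diagAverage_sub_diagMean {d n : ℕ} (hn : 0 < n) (a : Fin d → ℝ) (Δ : ℝ)
    (R : Finset (Fin d)) (y : Fin n → Fin d → ℝ) (s : Fin d) :
    diagAverage R y s - diagMean a Δ s =
      (n : ℝ)⁻¹ * ∑ l, (pairAverage R s (y l) - diagMean a Δ s) := by
  have hn' : (n : ℝ) ≠ 0 := by positivity
  have e : diagAverage R y s = (n : ℝ)⁻¹ * ∑ l, pairAverage R s (y l) := by
    simp only [diagAverage, pairAverage, ← Finset.mul_sum]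
    rw [one_div, mul_inv, mul_assoc]
  rw [e, Finset.sum_sub_distrib, Finset.sum_const, Finset.card_univ, Fintype.card_fin,
    nsmul_eq_mul, mul_sub, inv_mul_cancel_left₀ hn']

theorem toep_sub_estimator_apply {d n : ℕ} (a : Fin d → ℝ) (Δ : ℝ) (R : Finset (Fin d))
    (y : Fin n → Fin d → ℝ) (j k : Fin d) :
    (toep a - estimator Δ R y) j k =
      -(diagAverage R y (indexDist j k) - diagMean a Δ (indexDist j k)) := by
  simp only [estimator, toep, diagMean, Matrix.sub_apply, Matrix.of_apply, Matrix.smul_apply,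
    Matrix.one_apply, indexDist_eq_zero_iff, smul_eq_mul]
  split_ifs <;> ring

theorem exists_le_abs_of_le_maxNorm {d : ℕ} (hd : 0 < d) {M : Matrix (Fin d) (Fin d) ℝ} {t : ℝ}
    (h : t ≤ maxNorm M) : ∃ j k, t ≤ |M j k| := by
  have : Nonempty (Fin d × Fin d) := ⟨(⟨0, hd⟩, ⟨0, hd⟩)⟩
  obtain ⟨p, hp⟩ := exists_eq_ciSup_of_finite (f := fun p : Fin d × Fin d => |M p.1 p.2|)
  exact ⟨p.1, p.2, h.trans hp.ge⟩

theorem opNorm_nonneg {d : ℕ} (T : Matrix (Fin d) (Fin d) ℝ) : 0 ≤ opNorm T := norm_nonneg _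

theorem maxNorm_nonneg {d : ℕ} (T : Matrix (Fin d) (Fin d) ℝ) : 0 ≤ maxNorm T :=
  Real.iSup_nonneg fun _ => abs_nonneg _

theorem scaleK_pos {d : ℕ} (T : Matrix (Fin d) (Fin d) ℝ) {Δ : ℝ} (hΔ : 0 < Δ) :
    0 < scaleK T Δ := by
  have := opNorm_nonneg T
  unfold scaleK
  positivity

theorem maxNorm_le_scaleK {d : ℕ} (hd : 0 < d) (T : Matrix (Fin d) (Fin d) ℝ) (Δ : ℝ) :
    maxNorm T ≤ scaleK T Δ := by
  obtain ⟨j, k, h⟩ := exists_le_abs_of_le_maxNorm hd (le_refl (maxNorm T))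
  have h1 := abs_entry_le_opNorm T j k
  have h2 := opNorm_nonneg T
  unfold scaleK
  nlinarith [sq_nonneg Δ]

theorem IsRuler.abs_diagMean_le {d : ℕ} {R : Finset (Fin d)} (hR : IsRuler R) (a : Fin d → ℝ)
    (Δ : ℝ) (s : Fin d) : |diagMean a Δ s| ≤ scaleK (toep a) Δ / 2 := by
  obtain ⟨j, -, k, -, h⟩ := hR s
  have h1 := abs_entry_le_opNorm (toep a) j k
  rw [toep, Matrix.of_apply, h, ← toep] at h1
  have h2 := abs_add_le (a s) (if (s : ℕ) = 0 then Δ ^ 2 / 4 else 0)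
  have h3 : |if (s : ℕ) = 0 then Δ ^ 2 / 4 else 0| ≤ Δ ^ 2 / 4 := by
    split_ifs
    · rw [abs_of_nonneg (by positivity)]
    · rw [abs_zero]
      positivity
  unfold diagMean scaleK
  nlinarith [sq_nonneg Δ]

theorem exp_half_add_le (u v : ℝ) : Real.exp ((u + v) / 2) ≤ (Real.exp u + Real.exp v) / 2 := by
  have h1 : Real.exp ((u + v) / 2) = Real.exp (u / 2) * Real.exp (v / 2) := by
    rw [← Real.exp_add]
    ring_nf
  have h2 (w : ℝ) : Real.exp w = Real.exp (w / 2) ^ 2 := by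
    rw [sq, ← Real.exp_add]
    ring_nf
  rw [h1, h2 u, h2 v]
  nlinarith [sq_nonneg (Real.exp (u / 2) - Real.exp (v / 2))]

/-- Jensen's inequality moves the exponential inside the average over pairs; within a pair, AM-GM
separates the two coordinates, so only one-dimensional Gaussian moments remain. -/
theorem exp_abs_pairAverage_sub_le {d : ℕ} {R : Finset (Fin d)} {s : Fin d}
    (hs : (rulerPairs R s).Nonempty) {y x : Fin d → ℝ} {Δ K m : ℝ} (hK : 4 * Δ ^ 2 ≤ K)
    (hK0 : 0 < K) (hm : |m| ≤ K / 2) (hy : ∀ i, y i ^ 2 ≤ 2 * x i ^ 2 + 9 / 2 * Δ ^ 2) :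
    Real.exp |(4 * K)⁻¹ * (pairAverage R s y - m)| ≤
      ∑ p ∈ rulerPairs R s, ((rulerPairs R s).card : ℝ)⁻¹ *
        (Real.exp ((2 * K)⁻¹ * x p.1 ^ 2) + Real.exp ((2 * K)⁻¹ * x p.2 ^ 2)) := by
  set w := ((rulerPairs R s).card : ℝ)⁻¹ with hw
  have hw0 : 0 ≤ w := by positivity
  have hcard : ((rulerPairs R s).card : ℝ) ≠ 0 := by
    exact_mod_cast (Finset.card_pos.2 hs).ne'
  have hw1 : ∑ _p ∈ rulerPairs R s, w = 1 := by
    rw [Finset.sum_const, nsmul_eq_mul, hw, mul_inv_cancel₀ hcard]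
  have hterm (p : Fin d × Fin d) : (4 * K)⁻¹ * (|y p.1 * y p.2| + |m|) ≤
      ((2 * K)⁻¹ * x p.1 ^ 2 + (2 * K)⁻¹ * x p.2 ^ 2) / 2 + 13 / 32 := by
    -- Here `9/2 * Δ² ≤ 9/8 * K`. Adding `|m| ≤ K/2` and dividing by `4K` produces `(9/8 + 1/2) / 4
    -- = 13/32`.
    have h1 : |y p.1 * y p.2| ≤ x p.1 ^ 2 + x p.2 ^ 2 + 9 / 8 * K := by
      rw [abs_mul]
      nlinarith [hy p.1, hy p.2, sq_nonneg (|y p.1| - |y p.2|), sq_abs (y p.1), sq_abs (y p.2)]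
    calc (4 * K)⁻¹ * (|y p.1 * y p.2| + |m|)
        ≤ (4 * K)⁻¹ * (x p.1 ^ 2 + x p.2 ^ 2 + 9 / 8 * K + K / 2) := by gcongr
      _ = ((2 * K)⁻¹ * x p.1 ^ 2 + (2 * K)⁻¹ * x p.2 ^ 2) / 2 + 13 / 32 := by
        field_simp
        ring
  have habs : |(4 * K)⁻¹ * (pairAverage R s y - m)| ≤
      ∑ p ∈ rulerPairs R s, w • ((4 * K)⁻¹ * (|y p.1 * y p.2| + |m|)) := by
    have e : ∑ p ∈ rulerPairs R s, w • ((4 * K)⁻¹ * (|y p.1 * y p.2| + |m|)) =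
        (4 * K)⁻¹ * (∑ p ∈ rulerPairs R s, w * |y p.1 * y p.2| + |m|) := by
      have : |m| = ∑ _p ∈ rulerPairs R s, w * |m| := by rw [← Finset.sum_mul, hw1, one_mul]
      rw [this, ← Finset.sum_add_distrib, Finset.mul_sum, ← this]
      refine Finset.sum_congr rfl fun p _ => ?_
      rw [smul_eq_mul]
      ring
    rw [e, abs_mul, abs_of_nonneg (by positivity : (0 : ℝ) ≤ (4 * K)⁻¹)]
    gcongr
    refine (abs_sub _ _).trans (add_le_add_left ?_ _)
    refine (Finset.abs_sum_le_sum_abs _ _).trans (Finset.sum_le_sum fun p _ => ?_)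
    rw [abs_mul, abs_of_nonneg hw0]
  -- This 2 cancels the `1/2` in `exp_half_add_le`.
  have hconst : Real.exp (13 / 32) ≤ 2 := by
    rw [← Real.le_log_iff_exp_le two_pos]
    linarith [Real.log_two_gt_d9]
  refine (Real.exp_le_exp.2 habs).trans ?_
  refine (convexOn_exp.map_sum_le (fun _ _ => hw0) hw1 fun _ _ => Set.mem_univ _).trans ?_
  refine Finset.sum_le_sum fun p _ => ?_
  rw [smul_eq_mul]
  refine mul_le_mul_of_nonneg_left ?_ hw0
  refine (Real.exp_le_exp.2 (hterm p)).trans ?_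
  rw [Real.exp_add]
  have h1 := exp_half_add_le ((2 * K)⁻¹ * x p.1 ^ 2) ((2 * K)⁻¹ * x p.2 ^ 2)
  have h2 := mul_le_mul h1 hconst (Real.exp_pos _).le (by positivity)
  linarith

/-! ### Concentration of the averages and of the estimator -/

section Model

variable {Ω : Type*} [MeasurableSpace Ω] {P : Measure Ω} {d n : ℕ}
  {a : Fin d → ℝ} {Δ : ℝ} {x : Fin n → Ω → EuclideanSpace ℝ (Fin d)}
  {τ : Fin n → Ω → Fin d → ℝ} {R : Finset (Fin d)}

theorem IsDitheredGaussianSample.iIndepFun_quantizedData {T : Matrix (Fin d) (Fin d) ℝ}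
    (h : IsDitheredGaussianSample P T Δ x τ) :
    iIndepFun (fun l ω => quantizedData Δ x τ ω l) P :=
  h.indep_across.comp
    (fun _ (p : EuclideanSpace ℝ (Fin d) × (Fin d → ℝ)) i => quantize Δ (p.1 i + p.2 i))
    fun _ => measurable_pi_lambda _ fun i => (measurable_quantize Δ).comp (by fun_prop)

theorem IsDitheredGaussianSample.exp_abs_pairAverage_sub (hR : IsRuler R)
    (h : IsDitheredGaussianSample P (toep a) Δ x τ) (hT : (toep a).PosSemidef) (hΔ : 0 < Δ)
    (s : Fin d) (l : Fin n) :
    Integrable (fun ω => Real.exp |(4 * scaleK (toep a) Δ)⁻¹ *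
        (pairAverage R s (quantizedData Δ x τ ω l) - diagMean a Δ s)|) P ∧
      ∫ ω, Real.exp |(4 * scaleK (toep a) Δ)⁻¹ *
        (pairAverage R s (quantizedData Δ x τ ω l) - diagMean a Δ s)| ∂P ≤ 3 := by
  set K := scaleK (toep a) Δ with hK
  have hK0 : 0 < K := scaleK_pos _ hΔ
  have hK4 : 4 * Δ ^ 2 ≤ K := by
    have := opNorm_nonneg (toep a)
    rw [hK, scaleK]
    linarith
  have hs := hR.rulerPairs_nonempty s
  have hcard : ((rulerPairs R s).card : ℝ) ≠ 0 := by
    exact_mod_cast (Finset.card_pos.2 hs).ne'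
  -- Since `T i i ≤ ‖T‖₂ ≤ K/2`, the weight `(2K)⁻¹` stays within the limit `1/4`.
  have hcoord (i : Fin d) := h.exp_mul_sq_coord hT l i (a := (2 * K)⁻¹) (by
    have h1 := (le_abs_self _).trans (abs_entry_le_opNorm (toep a) i i)
    rw [inv_mul_le_iff₀ (by positivity)]
    rw [hK, scaleK]
    linarith [sq_nonneg Δ])
  let g : Ω → ℝ := fun ω => ∑ p ∈ rulerPairs R s, ((rulerPairs R s).card : ℝ)⁻¹ *
    (Real.exp ((2 * K)⁻¹ * x l ω p.1 ^ 2) + Real.exp ((2 * K)⁻¹ * x l ω p.2 ^ 2))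
  have hgi : Integrable g P := integrable_finsetSum _ fun p _ =>
    ((hcoord p.1).1.add (hcoord p.2).1).const_mul _
  have hle : ∀ᵐ ω ∂P, Real.exp |(4 * K)⁻¹ *
      (pairAverage R s (quantizedData Δ x τ ω l) - diagMean a Δ s)| ≤ g ω := by
    filter_upwards [h.ae_quantizedData_sq_le hΔ l] with ω hω
    exact exp_abs_pairAverage_sub_le hs hK4 hK0 (hR.abs_diagMean_le a Δ s) hω
  have hQ : AEMeasurable (fun ω => pairAverage R s (quantizedData Δ x τ ω l)) P :=
    (measurable_pairAverage R s).comp_aemeasurable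
      (aemeasurable_pi_lambda _ fun i => h.aemeasurable_quantizedData l i)
  have hint : Integrable (fun ω => Real.exp |(4 * K)⁻¹ *
      (pairAverage R s (quantizedData Δ x τ ω l) - diagMean a Δ s)|) P := by
    refine hgi.mono' (AEMeasurable.aestronglyMeasurable ?_) ?_
    · exact Real.measurable_exp.comp_aemeasurable
        (measurable_abs.comp_aemeasurable ((hQ.sub_const _).const_mul _))
    · simpa only [Real.norm_eq_abs, Real.abs_exp] using hle
  refine ⟨hint, (integral_mono_ae hint hgi hle).trans ?_⟩
  -- Each pair contributes two Gaussian moments of at most `√2`, hence the bound 3.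
  have hsqrt : √2 ≤ (3 / 2 : ℝ) := by
    rw [Real.sqrt_le_left (by norm_num)]
    norm_num
  calc ∫ ω, g ω ∂P
      = ∑ p ∈ rulerPairs R s, ((rulerPairs R s).card : ℝ)⁻¹ *
          (∫ ω, Real.exp ((2 * K)⁻¹ * x l ω p.1 ^ 2) ∂P +
            ∫ ω, Real.exp ((2 * K)⁻¹ * x l ω p.2 ^ 2) ∂P) := by
        rw [integral_finsetSum _ fun p _ => ((hcoord p.1).1.add (hcoord p.2).1).const_mul _]
        refine Finset.sum_congr rfl fun p _ => ?_
        rw [integral_const_mul, integral_add (hcoord p.1).1 (hcoord p.2).1]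
    _ ≤ ∑ p ∈ rulerPairs R s, ((rulerPairs R s).card : ℝ)⁻¹ * 3 := by
        refine Finset.sum_le_sum fun p _ => mul_le_mul_of_nonneg_left ?_ (by positivity)
        linarith [(hcoord p.1).2, (hcoord p.2).2]
    _ = 3 := by
        rw [Finset.sum_const, nsmul_eq_mul, mul_inv_cancel_left₀ hcard]

variable [IsProbabilityMeasure P]

theorem IsDitheredGaussianSample.integral_pairAverage (hR : IsRuler R)
    (h : IsDitheredGaussianSample P (toep a) Δ x τ) (hT : (toep a).PosSemidef) (hΔ : 0 < Δ)
    (s : Fin d) (l : Fin n) :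
    Integrable (fun ω => pairAverage R s (quantizedData Δ x τ ω l)) P ∧
      ∫ ω, pairAverage R s (quantizedData Δ x τ ω l) ∂P = diagMean a Δ s := by
  have hcard : ((rulerPairs R s).card : ℝ) ≠ 0 := by
    exact_mod_cast (Finset.card_pos.2 (hR.rulerPairs_nonempty s)).ne'
  have hi (p : Fin d × Fin d) : Integrable (fun ω => ((rulerPairs R s).card : ℝ)⁻¹ *
      (quantizedData Δ x τ ω l p.1 * quantizedData Δ x τ ω l p.2)) P :=
    ((h.memLp_quantizedData hT hΔ l p.1).integrable_mul
      (h.memLp_quantizedData hT hΔ l p.2)).const_mul _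
  have hpair : ∀ p ∈ rulerPairs R s,
      ∫ ω, quantizedData Δ x τ ω l p.1 * quantizedData Δ x τ ω l p.2 ∂P = diagMean a Δ s := by
    rintro ⟨j, k⟩ hp
    have hjk : indexDist j k = s := (Finset.mem_filter.1 hp).2
    subst hjk
    rw [diagMean]
    simp only [indexDist_eq_zero_iff]
    split_ifs with hc
    · subst hc
      simp only [← sq]
      exact integral_quantizedData_sq h hT hΔ l j
    · rw [add_zero]
      exact integral_quantizedData_mul_of_ne h hT hΔ l hc
  refine ⟨integrable_finsetSum _ fun p _ => hi p, ?_⟩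
  unfold pairAverage
  rw [integral_finsetSum _ fun p _ => hi p]
  simp only [integral_const_mul]
  rw [Finset.sum_congr rfl fun p hp => by rw [hpair p hp], Finset.sum_const, nsmul_eq_mul,
    mul_inv_cancel_left₀ hcard]

theorem IsDitheredGaussianSample.diagAverage_tail (hn : 0 < n) (hR : IsRuler R)
    (h : IsDitheredGaussianSample P (toep a) Δ x τ) (hT : (toep a).PosSemidef) (hΔ : 0 < Δ)
    (s : Fin d) {t : ℝ} (ht : 0 ≤ t) :
    P.real {ω | t ≤ |diagAverage R (quantizedData Δ x τ ω) s - diagMean a Δ s|} ≤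
      2 * Real.exp (-(2 * (1 / 3072 * n *
        min (t ^ 2 / scaleK (toep a) Δ ^ 2) (t / scaleK (toep a) Δ)))) := by
  set K := scaleK (toep a) Δ with hK
  have hK0 : 0 < K := scaleK_pos _ hΔ
  have hn' : (0 : ℝ) < n := by exact_mod_cast hn
  let Y : Fin n → Ω → ℝ := fun l ω =>
    (4 * K)⁻¹ * (pairAverage R s (quantizedData Δ x τ ω l) - diagMean a Δ s)
  have hYind : iIndepFun Y P := h.iIndepFun_quantizedData.comp
    (fun _ y => (4 * K)⁻¹ * (pairAverage R s y - diagMean a Δ s))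
    fun _ => ((measurable_pairAverage R s).sub_const _).const_mul _
  have hYm (l : Fin n) : AEMeasurable (Y l) P :=
    ((h.integral_pairAverage hR hT hΔ s l).1.aemeasurable.sub_const _).const_mul _
  have hY0 (l : Fin n) : ∫ ω, Y l ω ∂P = 0 := by
    have h1 := h.integral_pairAverage hR hT hΔ s l
    rw [integral_const_mul, integral_sub h1.1 (integrable_const _), h1.2]
    simp
  have hexp (l : Fin n) := h.exp_abs_pairAverage_sub hR hT hΔ s l
  have hb := bernstein (M := 3) (by norm_num) hYind hYm hY0 (fun l => (hexp l).1)
    (fun l => (hexp l).2) (s := t / (4 * K)) (by positivity)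
  have hset : {ω | t ≤ |diagAverage R (quantizedData Δ x τ ω) s - diagMean a Δ s|} ⊆
      {ω | n * (t / (4 * K)) ≤ |∑ l, Y l ω|} := by
    intro ω hω
    rw [Set.mem_ofPred_eq] at hω ⊢
    rw [diagAverage_sub_diagMean hn, abs_mul, abs_of_pos (inv_pos.2 hn'),
      le_inv_mul_iff₀ hn'] at hω
    rw [← Finset.mul_sum, abs_mul, abs_of_pos (by positivity : 0 < (4 * K)⁻¹),
      le_inv_mul_iff₀ (by positivity)]
    refine le_of_eq_of_le ?_ hω
    field_simp
  refine (measureReal_mono hset).trans (hb.trans ?_)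
  -- Rescaling by 4 costs at most 16. With `32 * M = 96` the rate is `1/1536 = 2/3072`; the factor 2
  -- is spent in the union bound.
  have hmin : min (t ^ 2 / K ^ 2) (t / K) / 16 ≤ min ((t / (4 * K)) ^ 2) (t / (4 * K)) := by
    have e1 : (t / (4 * K)) ^ 2 = t ^ 2 / K ^ 2 / 16 := by
      field_simp
      norm_num
    have e2 : t / (4 * K) = t / K / 4 := by
      field_simp
    have h2 : 0 ≤ t / K := by positivity
    rw [e1, e2]
    refine le_min ?_ ?_
    · linarith [min_le_left (t ^ 2 / K ^ 2) (t / K)]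
    · linarith [min_le_right (t ^ 2 / K ^ 2) (t / K)]
  have h3 := mul_le_mul_of_nonneg_left hmin hn'.le
  gcongr
  linarith

theorem IsDitheredGaussianSample.maxNorm_tail (hd : 0 < d) (hn : 0 < n) (hR : IsRuler R)
    (h : IsDitheredGaussianSample P (toep a) Δ x τ) (hT : (toep a).PosSemidef) (hΔ : 0 < Δ)
    (t : ℝ) :
    P.real {ω | t ≤ maxNorm (toep a - estimator Δ R (quantizedData Δ x τ ω))} ≤
      2 * (R.card : ℝ) * Real.exp (-(1 / 3072 * (n : ℝ) *
        min (t ^ 2 / scaleK (toep a) Δ ^ 2) (t / scaleK (toep a) Δ))) := by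
  have hK0 : 0 < scaleK (toep a) Δ := scaleK_pos _ hΔ
  have hcard : (d : ℝ) ≤ (R.card : ℝ) ^ 2 := by exact_mod_cast hR.le_card_sq
  have hcard1 : (1 : ℝ) ≤ R.card := by
    obtain ⟨j, hj, -⟩ := hR ⟨0, hd⟩
    exact_mod_cast Finset.card_pos.2 ⟨j, hj⟩
  set u := 1 / 3072 * (n : ℝ) * min (t ^ 2 / scaleK (toep a) Δ ^ 2) (t / scaleK (toep a) Δ)
    with hu
  rcases lt_or_ge t 0 with ht | ht
  · have h1 : min (t ^ 2 / scaleK (toep a) Δ ^ 2) (t / scaleK (toep a) Δ) ≤ 0 :=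
      (min_le_right _ _).trans (div_nonpos_of_nonpos_of_nonneg ht.le hK0.le)
    have h2 : 1 ≤ Real.exp (-u) := by
      rw [Real.one_le_exp_iff, hu, neg_nonneg]
      exact mul_nonpos_of_nonneg_of_nonpos (by positivity) h1
    nlinarith [measureReal_le_one (μ := P)
      (s := {ω | t ≤ maxNorm (toep a - estimator Δ R (quantizedData Δ x τ ω))})]
  · have hsub : {ω | t ≤ maxNorm (toep a - estimator Δ R (quantizedData Δ x τ ω))} ⊆
        ⋃ s : Fin d, {ω | t ≤ |diagAverage R (quantizedData Δ x τ ω) s - diagMean a Δ s|} := by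
      intro ω hω
      obtain ⟨j, k, hjk⟩ := exists_le_abs_of_le_maxNorm hd hω
      rw [toep_sub_estimator_apply, abs_neg] at hjk
      exact Set.mem_iUnion.2 ⟨indexDist j k, hjk⟩
    have h1 := (measureReal_mono (μ := P) hsub).trans (measureReal_iUnion_fintype_le _)
    have h2 := h1.trans (Finset.sum_le_sum fun s _ => h.diagAverage_tail hn hR hT hΔ s ht)
    rw [← hu, Finset.sum_const, Finset.card_univ, Fintype.card_fin, nsmul_eq_mul] at h2
    have h3 : Real.exp (-(2 * u)) = Real.exp (-u) ^ 2 := by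
      rw [sq, ← Real.exp_add]
      ring_nf
    have h4 := Real.exp_pos (-u)
    rw [h3] at h2
    -- The union bound gives `2 (|R| exp (-u))²`. If `|R| exp (-u) ≤ 1`, the square is at most its
    -- base; otherwise the claimed bound exceeds 1.
    rcases le_total ((R.card : ℝ) * Real.exp (-u)) 1 with hq | hq
    · have h5 := mul_le_mul_of_nonneg_right hcard (sq_nonneg (Real.exp (-u)))
      have h6 : 0 ≤ (R.card : ℝ) * Real.exp (-u) := by positivity
      nlinarith
    · linarith [measureReal_le_one (μ := P)
        (s := {ω | t ≤ maxNorm (toep a - estimator Δ R (quantizedData Δ x τ ω))})]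

end Model

end QuantizedToeplitz

end

theorem mainTheorem5 :
    ∃ c : ℝ, 0 < c ∧
      ∀ (d n : ℕ), 0 < d → 0 < n →
      ∀ (T : Matrix (Fin d) (Fin d) ℝ), T.PosSemidef → QuantizedToeplitz.IsSymmToeplitz T →
      ∀ (Δ : ℝ), 0 < Δ →
      ∀ (R : Finset (Fin d)), QuantizedToeplitz.IsRuler R →
      ∀ (Ω : Type*) [MeasurableSpace Ω] (P : Measure Ω) [IsProbabilityMeasure P]
        (x : Fin n → Ω → EuclideanSpace ℝ (Fin d)) (τ : Fin n → Ω → Fin d → ℝ),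
        QuantizedToeplitz.IsDitheredGaussianSample P T Δ x τ →
        (∀ t : ℝ,
          P.real {ω | t ≤ QuantizedToeplitz.maxNorm
              (T - QuantizedToeplitz.estimator Δ R (QuantizedToeplitz.quantizedData Δ x τ ω))} ≤
            2 * (R.card : ℝ) *
              Real.exp (-(c * (n : ℝ) * min (t ^ 2 / QuantizedToeplitz.scaleK T Δ ^ 2)
                (t / QuantizedToeplitz.scaleK T Δ)))) ∧
        (∀ ε : ℝ, 0 < ε → ε ≤ 1 →
          P.real {ω | ε * QuantizedToeplitz.maxNorm T ≤ QuantizedToeplitz.maxNorm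
              (T - QuantizedToeplitz.estimator Δ R (QuantizedToeplitz.quantizedData Δ x τ ω))} ≤
            2 * (R.card : ℝ) *
              Real.exp (-(c * (n : ℝ) * ε ^ 2 * QuantizedToeplitz.maxNorm T ^ 2 /
                QuantizedToeplitz.scaleK T Δ ^ 2))) := by
  refine ⟨1 / 3072, by norm_num, ?_⟩
  rintro d n hd hn _ hT ⟨a, rfl⟩ Δ hΔ R hR Ω _ P _ x τ h
  refine ⟨h.maxNorm_tail hd hn hR hT hΔ, fun ε hε hε1 => ?_⟩
  refine (h.maxNorm_tail hd hn hR hT hΔ _).trans_eq ?_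
  have hK0 := QuantizedToeplitz.scaleK_pos (QuantizedToeplitz.toep a) hΔ
  have hTK := QuantizedToeplitz.maxNorm_le_scaleK hd (QuantizedToeplitz.toep a) Δ
  have hT0 := QuantizedToeplitz.maxNorm_nonneg (QuantizedToeplitz.toep a)
  set K := QuantizedToeplitz.scaleK (QuantizedToeplitz.toep a) Δ
  set m := QuantizedToeplitz.maxNorm (QuantizedToeplitz.toep a)
  have h0 : 0 ≤ ε * m / K := by positivity
  have h1 : ε * m / K ≤ 1 := by
    rw [div_le_one hK0]
    nlinarith
  -- As `ε ≤ 1` and every entry of `T` is at most `‖T‖₂ ≤ K` in absolute value, the ratio lies in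
  -- `[0, 1]` and the quadratic term is the smaller one.
  rw [min_eq_left (by rw [← div_pow]; nlinarith)]
  congr 3
  ring
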